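/- Theorem 2.4. Let $(X,\mathcal X,\mu)$ be a non-atomic standard Borel probability space, and let $T:X\to X$ be an invertible (bimeasurable) map which preserves $\mu$ and is ergodic. Suppose that $(X,\mathcal X,\mu,T)$ has twofold minimal self-joinings: every probability measure $\lambda$ on $X\times X$ that is invariant and ergodic under $T\times T$ and has both marginals equal to $\mu$ is either $\mu\times\mu$ or the image of $\mu$ under the map $x\mapsto (x,T^n x)$ for some $n\in\mathbb Z$. Then $(X,\mathcal X,\mu,T)$ is mildly mixing: if $f\in L^2(X,\mu)$ and there is a sequence $(t_i)$ in $\mathbb Z$ with $|t_i|\to\infty$ such that $f\circ T^{t_i}\to f$ in $L^2(X,\mu)$, then $f$ is almost everywhere equal to a constant. -/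

import Mathlib

open MeasureTheory Filter Topology

section

variable {X : Type*} [MeasurableSpace X]

/-- The transformation `T ^ n`, for `n` an integer, of an invertible bimeasurable map `T`;
negative powers are powers of the inverse. -/
def zIter (T : X ≃ᵐ X) (n : ℤ) : X → X :=
  ((T.toEquiv : Equiv.Perm X) ^ n : Equiv.Perm X)

theorem measurable_zIter (T : X ≃ᵐ X) (n : ℤ) : Measurable (zIter T n) := by
  have key : ∀ (S : X ≃ᵐ X) (k : ℕ),
      Measurable (((S.toEquiv : Equiv.Perm X) ^ k : Equiv.Perm X) : X → X) := by
    intro S k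
    rw [Equiv.Perm.coe_pow]
    exact S.measurable.iterate k
  cases n with
  | ofNat k => simpa [zIter] using key T k
  | negSucc k =>
    have h : zIter T (Int.negSucc k)
        = (((T.symm.toEquiv : Equiv.Perm X) ^ (k + 1) : Equiv.Perm X) : X → X) := by
      unfold zIter
      rw [zpow_negSucc, ← inv_pow]
      rfl
    rw [h]
    exact key T.symm (k + 1)

/-- `lam` is a twofold self-joining of `(X, μ, T)`: it is invariant under `T × T` and both of its
marginals are `μ`. (When `μ` is a probability measure, so is `lam`.) -/
structure IsSelfJoining (T : X ≃ᵐ X) (μ : Measure X) (lam : Measure (X × X)) : Prop where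
  invariant : MeasurePreserving (Prod.map T T) lam lam
  fst : lam.map Prod.fst = μ
  snd : lam.map Prod.snd = μ

/-- `(X, μ, T)` is ergodic and has twofold minimal self-joinings: every ergodic twofold
self-joining is either the product measure or the image of `μ` under `x ↦ (x, T ^ n x)` for some
integer `n`. -/
structure HasTwofoldMSJ (T : X ≃ᵐ X) (μ : Measure X) : Prop where
  ergodic : Ergodic T μ
  minimal : ∀ lam : Measure (X × X), IsSelfJoining T μ lam → Ergodic (Prod.map T T) lam →
    lam = μ.prod μ ∨ ∃ n : ℤ, lam = μ.map (fun x => (x, zIter T n x))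

/-- `f` is a rigid function for the `ℤ`-system `(X, μ, T)`: it is square integrable, and there is
a sequence of integers `t i` that eventually leaves every compact (finite) set of integers, such
that `f ∘ T ^ (t i)` converges to `f` in `L²`. -/
def IsRigidFunction (T : X ≃ᵐ X) (μ : Measure X) (f : X → ℂ) : Prop :=
  MemLp f 2 μ ∧ ∃ t : ℕ → ℤ, Tendsto t atTop (cocompact ℤ) ∧
    Tendsto (fun i => eLpNorm (fun x => f (zIter T (t i) x) - f x) 2 μ) atTop (𝓝 0)

/-- The system is mildly mixing: every rigid function is almost everywhere constant. -/
def MildlyMixing (T : X ≃ᵐ X) (μ : Measure X) : Prop :=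
  ∀ f : X → ℂ, IsRigidFunction T μ f → ∃ c : ℂ, ∀ᵐ x ∂μ, f x = c

end

/-! Let `f` be a non-constant rigid function. The contradiction is that its orbit `{f ∘ T ^ n}` in
`L²` would be a nonempty perfect set, hence uncountable, although it is indexed by `ℤ`.

The orbit is closed. If `f ∘ T ^ (n k)` tends to `g`, then the processes `(f (T ^ j x))_j` and `(g
(T ^ j x))_j` have the same law, so the system can be joined to itself relatively independently over
this common factor, which gives a self-joining on which `g x = f y`. Some ergodic component keeps
this relation and both marginals. By minimality it is a graph, and then `g = f ∘ T ^ m`, or the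
product, and then `f` is constant.

The orbit has no isolated point. Rigidity brings `f ∘ T ^ (t i + n)` close to `f ∘ T ^ n`, and the
two differ when `t i ≠ 0`, because a non-constant `f` is not periodic. This last fact is weak
mixing: non-atomicity makes graphs null for `μ × μ`, so an ergodic component that avoids every graph
must be `μ × μ` itself.

The ergodic decomposition is obtained from conditional measures given the invariant sets, by way of
von Neumann's mean ergodic argument. -/

/-! ### Conditional measures on a standard Borel space -/

open ProbabilityTheory in
theorem ae_ae_condExpKernel_of_ae {Z : Type*} {m mZ : MeasurableSpace Z} [StandardBorelSpace Z]
    {lam : Measure Z} [IsFiniteMeasure lam] (hm : m ≤ mZ) {p : Z → Prop}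
    (hp : ∀ᵐ w ∂lam, p w) : ∀ᵐ z ∂lam, ∀ᵐ w ∂(condExpKernel lam m z), p w := by
  refine ae_of_ae_trim hm (Measure.ae_ae_of_ae_comp ?_)
  rwa [condExpKernel_comp_trim hm]

-- The trimmed measure composed with the kernel is the image of `lam` under `z ↦ (z, z)`, and the
-- two sides agree on the diagonal.
open ProbabilityTheory in
theorem ae_ae_condExpKernel_eq {Z : Type*} {m mZ : MeasurableSpace Z} [StandardBorelSpace Z]
    {lam : Measure Z} [IsFiniteMeasure lam] (hm : m ≤ mZ) {h : Z → ℝ}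
    (hh : Measurable[m] h) : ∀ᵐ z ∂lam, ∀ᵐ w ∂(condExpKernel lam m z), h w = h z := by
  refine ae_of_ae_trim hm (Measure.ae_ae_of_ae_compProd (p := fun q => h q.2 = h q.1) ?_)
  rw [compProd_trim_condExpKernel hm]
  have h1 : @Measurable (Z × Z) ℝ (m.prod mZ) _ fun q => h q.1 := hh.comp measurable_fst
  have h2 : @Measurable (Z × Z) ℝ (m.prod mZ) _ fun q => h q.2 :=
    (hh.mono hm le_rfl).comp measurable_snd
  have h3 : @Measurable Z (Z × Z) mZ (m.prod mZ) fun a => (id a, id a) :=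
    Measurable.prodMk (measurable_id'' hm) measurable_id
  refine (@ae_map_iff _ _ mZ (m.prod mZ) _ _ (@Measurable.aemeasurable _ _ mZ (m.prod mZ) _ _ h3) _
    ?_).2 (ae_of_all _ fun _ => rfl)
  have h4 : @Measurable (Z × Z) ℝ (m.prod mZ) _ fun q => h q.2 - h q.1 := h2.sub h1
  simpa only [Set.preimage, Set.mem_singleton_iff, sub_eq_zero] using
    h4 (measurableSet_singleton (0 : ℝ))

open ProbabilityTheory in
theorem lintegral_lintegral_condExpKernel {Z : Type*} {m mZ : MeasurableSpace Z}
    [StandardBorelSpace Z] {lam : Measure Z} [IsFiniteMeasure lam]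
    (hm : m ≤ mZ) {f : Z → ENNReal} (hf : Measurable f) :
    ∫⁻ z, ∫⁻ w, f w ∂(condExpKernel lam m z) ∂lam = ∫⁻ w, f w ∂lam := by
  rw [← lintegral_trim hm (hf.lintegral_kernel (κ := condExpKernel lam m))]
  conv_rhs => rw [← condExpKernel_comp_trim (μ := lam) hm]
  rw [Measure.lintegral_bind (Kernel.aemeasurable _) hf.aemeasurable]

/-! ### Invariant functions and the mean ergodic theorem -/

/-- An almost everywhere invariant function agrees almost everywhere with a strictly invariant
one. -/
theorem aestronglyMeasurable_invariants_of_comp_ae_eq {Z : Type*} [MeasurableSpace Z]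
    {lam : Measure Z} {S : Z → Z} (hS : Measure.QuasiMeasurePreserving S lam lam) {v : Z → ℝ}
    (hv : AEStronglyMeasurable v lam) (hvS : v ∘ S =ᵐ[lam] v) :
    AEStronglyMeasurable[MeasurableSpace.invariants S] v lam := by
  set u := hv.mk v with hu
  have hum : Measurable u := hv.stronglyMeasurable_mk.measurable
  have huS : u ∘ S =ᵐ[lam] u :=
    (hS.ae_eq_comp hv.ae_eq_mk.symm).trans (hvS.trans hv.ae_eq_mk)
  -- The limsup along the forward orbit ignores a shift of the index, so it is strictly invariant;
  -- values in `EReal` make it exist everywhere.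
  let V : Z → EReal := fun z => limsup (fun n : ℕ => ((u (S^[n] z) : ℝ) : EReal)) atTop
  have hVm : Measurable V := Measurable.limsup fun n =>
    measurable_coe_real_ereal.comp (hum.comp (hS.measurable.iterate n))
  have hVS : V ∘ S = V := by
    funext z
    have := Filter.limsup_nat_add (fun n : ℕ => ((u (S^[n] z) : ℝ) : EReal)) 1
    simpa only [V, Function.comp_apply, ← Function.iterate_succ_apply] using this
  have hVinv : Measurable[MeasurableSpace.invariants S] V :=
    MeasurableSpace.measurable_invariants_dom.2 ⟨hVm, fun s _ => by rw [hVS]⟩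
  refine ⟨fun z => (V z).toReal, (hVinv.ereal_toReal).stronglyMeasurable, ?_⟩
  have hall : ∀ n : ℕ, ∀ᵐ z ∂lam, u (S^[n] z) = u z := by
    intro n
    induction n with
    | zero => exact ae_of_all _ fun _ => rfl
    | succ n ih =>
      filter_upwards [huS, hS.ae ih] with z h1 h2
      rw [Function.iterate_succ_apply, h2]
      exact h1
  filter_upwards [ae_all_iff.2 hall, hv.ae_eq_mk] with z hz hz'
  simp only [V, hz, limsup_const, EReal.toReal_coe]
  exact hz'

/-- The difference between a square integrable function and its conditional expectation given the
invariant sets is a limit of coboundaries in `L¹`. -/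
theorem exists_coboundary_approx {Z : Type*} {m mZ : MeasurableSpace Z}
    {lam : Measure Z} [IsProbabilityMeasure lam] {S : Z → Z} (hS : MeasurePreserving S lam lam)
    (hinv : m = MeasurableSpace.invariants S)
    {f : Z → ℝ} (hf : MemLp f 2 lam) {ε : ENNReal} (hε : 0 < ε) :
    ∃ φ : Z → ℝ, Measurable φ ∧ Integrable φ lam ∧
      ∫⁻ z, ‖f z - (lam[f | m]) z - (φ (S z) - φ z)‖ₑ ∂lam < ε := by
  have hm : m ≤ mZ := hinv ▸ MeasurableSpace.invariants_le S
  have : Fact (m ≤ mZ) := ⟨hm⟩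
  let U : Lp ℝ 2 lam →L[ℝ] Lp ℝ 2 lam :=
    (Lp.compMeasurePreservingₗᵢ ℝ S hS).toContinuousLinearMap
  have hU : ∀ x : Lp ℝ 2 lam, (U x : Z → ℝ) =ᵐ[lam] x ∘ S := fun x =>
    Lp.coeFn_compMeasurePreserving x hS
  have hUn : ∀ x, ‖U x‖ = ‖x‖ := fun x => Lp.norm_compMeasurePreserving x hS
  let R : Submodule ℝ (Lp ℝ 2 lam) :=
    LinearMap.range (U - 1 : Lp ℝ 2 lam →L[ℝ] Lp ℝ 2 lam).toLinearMap
  have hR : Rᗮ ≤ lpMeas ℝ ℝ m 2 lam := by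
    intro x hx
    rw [mem_lpMeas_iff_aestronglyMeasurable, hinv]
    have hUx : U x = x := by
      -- Orthogonality to `U x - x` gives `⟪U x, x⟫ = ‖x‖²`. Since `‖U x‖ = ‖x‖`, this is equality
      -- in Cauchy–Schwarz.
      refine eq_of_norm_le_re_inner_eq_norm_sq (𝕜 := ℝ) (hUn x).le ?_
      have : ∀ y, inner ℝ (U y) x = inner ℝ y x := fun y => by
        have h0 : inner ℝ (U y - y) x = 0 := (Submodule.mem_orthogonal _ _).1 hx _ ⟨y, rfl⟩
        rwa [inner_sub_left, sub_eq_zero] at h0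
      simp [this]
    refine aestronglyMeasurable_invariants_of_comp_ae_eq hS.quasiMeasurePreserving
      (Lp.aestronglyMeasurable x) ?_
    exact (hU x).symm.trans (by rw [hUx])
  -- The difference is orthogonal to every `m`-measurable function, hence to `Rᗮ`, and `Rᗮᗮ` is the
  -- closure of `R`.
  have hcl : hf.toLp f - (condExpL2 ℝ ℝ hm (hf.toLp f) : Lp ℝ 2 lam) ∈
      closure (R : Set (Lp ℝ 2 lam)) := by
    rw [← Submodule.topologicalClosure_coe, ← Submodule.orthogonal_orthogonal_eq_closure]
    exact Submodule.orthogonal_le hR (Submodule.sub_starProjection_mem_orthogonal _)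
  obtain ⟨y, ⟨x, rfl⟩, hy⟩ := EMetric.mem_closure_iff.1 hcl ε hε
  refine ⟨(Lp.aestronglyMeasurable x).mk x,
    (Lp.aestronglyMeasurable x).stronglyMeasurable_mk.measurable,
    ((Lp.memLp x).integrable (by norm_num)).congr (Lp.aestronglyMeasurable x).ae_eq_mk, ?_⟩
  refine lt_of_le_of_lt ?_ hy
  rw [Lp.edist_def, ← eLpNorm_one_eq_lintegral_enorm]
  refine le_trans (le_of_eq (eLpNorm_congr_ae ?_))
    (eLpNorm_le_eLpNorm_of_exponent_le (by norm_num) (by fun_prop))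
  have h1 := (Lp.aestronglyMeasurable x).ae_eq_mk
  have h2 := hS.quasiMeasurePreserving.ae_eq_comp h1
  have h3 := hf.condExpL2_ae_eq_condExp (𝕜 := ℝ) hm
  filter_upwards [h1, h2, h3, hU x, hf.coeFn_toLp,
    Lp.coeFn_sub (hf.toLp f) (condExpL2 ℝ ℝ hm (hf.toLp f) : Lp ℝ 2 lam),
    Lp.coeFn_sub (U x) x] with z h1 h2 h3 h4 h5 h6 h7
  simp only [Function.comp_apply] at h2 h4
  have h8 : (((U - 1 : Lp ℝ 2 lam →L[ℝ] Lp ℝ 2 lam).toLinearMap x : Lp ℝ 2 lam) : Z → ℝ) z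
      = U x z - x z := h7
  simp only [Pi.sub_apply] at h6 ⊢
  rw [h8, h6, h5, h3, h4, h2, h1]

/-! ### Ergodic decomposition -/

/-- A countably generated σ-algebra is generated by a countable π-system. -/
theorem exists_countable_isPiSystem_generateFrom (Z : Type*) [mZ : MeasurableSpace Z]
    [MeasurableSpace.CountablyGenerated Z] :
    ∃ A : Set (Set Z), A.Countable ∧ IsPiSystem A ∧ mZ = MeasurableSpace.generateFrom A ∧
      ∀ C ∈ A, MeasurableSet C := by
  have h : mZ = MeasurableSpace.generateFrom
      (generateSetAlgebra (MeasurableSpace.countableGeneratingSet Z)) := by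
    rw [generateFrom_generateSetAlgebra_eq, MeasurableSpace.generateFrom_countableGeneratingSet]
  refine ⟨_, countable_generateSetAlgebra
    (MeasurableSpace.countable_countableGeneratingSet (α := Z)), ?_, h, fun C hC => ?_⟩
  · intro s hs t ht _
    exact isSetAlgebra_generateSetAlgebra.inter_mem hs ht
  · rw [h]
    exact MeasurableSpace.measurableSet_generateFrom hC

-- An invariant set `B` equals `S ⁻¹' B`, so `S ⁻¹' C` and `C` meet it in equal measure.
open ProbabilityTheory in
theorem condExp_indicator_preimage_ae_eq {Z : Type*} {m mZ : MeasurableSpace Z}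
    {lam : Measure Z} [IsProbabilityMeasure lam] {S : Z → Z} (hS : MeasurePreserving S lam lam)
    (hinv : m = MeasurableSpace.invariants S) {C : Set Z} (hC : MeasurableSet C) :
    lam⟦S ⁻¹' C | m⟧ =ᵐ[lam] lam⟦C | m⟧ := by
  have hm : m ≤ mZ := hinv ▸ MeasurableSpace.invariants_le S
  have hSC : MeasurableSet (S ⁻¹' C) := hS.measurable hC
  refine (ae_eq_condExp_of_forall_setIntegral_eq hm ((integrable_const _).indicator hC)
    (fun _ _ _ => integrable_condExp.integrableOn) (fun B hB _ => ?_)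
    stronglyMeasurable_condExp.aestronglyMeasurable)
  have hB' : MeasurableSet B ∧ S ⁻¹' B = B := by
    rw [hinv] at hB
    exact MeasurableSpace.measurableSet_invariants.1 hB
  rw [setIntegral_condExp hm ((integrable_const _).indicator hSC) hB]
  rw [setIntegral_indicator hSC, setIntegral_indicator hC, setIntegral_const, setIntegral_const]
  congr 1
  conv_lhs => rw [← hB'.2, ← Set.preimage_inter]
  exact hS.measureReal_preimage (hB'.1.inter hC).nullMeasurableSet

-- A countable generating π-system lets a single null set take care of all measurable sets.
open ProbabilityTheory in
theorem ae_measurePreserving_condExpKernel {Z : Type*} {m mZ : MeasurableSpace Z}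
    [StandardBorelSpace Z] {lam : Measure Z} [IsProbabilityMeasure lam] {S : Z → Z}
    (hS : MeasurePreserving S lam lam) (hinv : m = MeasurableSpace.invariants S) :
    ∀ᵐ z ∂lam, MeasurePreserving S (condExpKernel lam m z) (condExpKernel lam m z) := by
  have hm : m ≤ mZ := hinv ▸ MeasurableSpace.invariants_le S
  obtain ⟨A, hAc, hAp, hAg, hAm⟩ := exists_countable_isPiSystem_generateFrom Z
  have key : ∀ᵐ z ∂lam, ∀ C ∈ A,
      (condExpKernel lam m z).real (S ⁻¹' C) = (condExpKernel lam m z).real C := by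
    rw [ae_ball_iff hAc]
    intro C hC
    filter_upwards [condExpKernel_ae_eq_condExp hm (μ := lam) (hAm C hC),
      condExpKernel_ae_eq_condExp hm (μ := lam) (hS.measurable (hAm C hC)),
      condExp_indicator_preimage_ae_eq hS hinv (hAm C hC)] with z h1 h2 h3
    rw [h1, h2, h3]
  filter_upwards [key] with z hz
  refine ⟨hS.measurable, ?_⟩
  have : IsProbabilityMeasure ((condExpKernel lam m z).map S) :=
    Measure.isProbabilityMeasure_map hS.measurable.aemeasurable
  refine ext_of_generate_finite A hAg hAp (fun C hC => ?_) (by simp)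
  rw [Measure.map_apply hS.measurable (hAm C hC)]
  exact (measureReal_eq_measureReal_iff).1 (hz C hC)

open ProbabilityTheory in
/-- For almost every component of the disintegration over the invariant sets, every invariant set
is independent of `C`. -/
theorem ae_condExpKernel_inter_eq_mul {Z : Type*} {m mZ : MeasurableSpace Z}
    [StandardBorelSpace Z] {lam : Measure Z} [IsProbabilityMeasure lam] {S : Z → Z}
    (hS : MeasurePreserving S lam lam) (hinv : m = MeasurableSpace.invariants S)
    {C : Set Z} (hC : MeasurableSet C) :
    ∀ᵐ z ∂lam, ∀ D : Set Z, MeasurableSet D → S ⁻¹' D = D →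
      (condExpKernel lam m z).real (C ∩ D)
        = (condExpKernel lam m z).real C * (condExpKernel lam m z).real D := by
  have hm : m ≤ mZ := hinv ▸ MeasurableSpace.invariants_le S
  have hf : MemLp (C.indicator fun _ => (1 : ℝ)) 2 lam := memLp_indicator_const 2 hC 1 (by simp)
  -- Summable errors: the fibrewise `L¹` norms of `e k` then have a finite sum, so tend to `0`, on
  -- almost every fibre. The exceptional null set depends on `C` but not on `D`.
  have hpos : ∀ k : ℕ, (0 : ENNReal) < 2⁻¹ ^ k := fun k =>
    ENNReal.pow_pos (by simp) k
  choose φ hφm hφi hφ using fun k : ℕ => exists_coboundary_approx hS hinv hf (hpos k)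
  set h : Z → ℝ := lam⟦C | m⟧ with hh
  have hhm : Measurable[m] h := stronglyMeasurable_condExp.measurable
  set e : ℕ → Z → ℝ := fun k z => C.indicator (fun _ => (1 : ℝ)) z - h z - (φ k (S z) - φ k z)
  have hem : ∀ k, Measurable (e k) := fun k =>
    ((measurable_const.indicator hC).sub (hhm.mono hm le_rfl)).sub
      (((hφm k).comp hS.measurable).sub (hφm k))
  have hsum : ∀ᵐ z ∂lam, ∑' k, ∫⁻ w, ‖e k w‖ₑ ∂(condExpKernel lam m z) ≠ ⊤ := by
    have hmeas : ∀ k, Measurable fun z => ∫⁻ w, ‖e k w‖ₑ ∂(condExpKernel lam m z) := fun k =>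
      ((hem k).enorm.lintegral_kernel (κ := condExpKernel lam m)).mono hm le_rfl
    have hfin : ∫⁻ z, ∑' k, ∫⁻ w, ‖e k w‖ₑ ∂(condExpKernel lam m z) ∂lam ≠ ⊤ := by
      rw [lintegral_tsum fun k => (hmeas k).aemeasurable]
      simp_rw [lintegral_lintegral_condExpKernel hm (hem _).enorm]
      refine ne_top_of_le_ne_top ?_ (ENNReal.tsum_le_tsum fun k => (hφ k).le)
      rw [ENNReal.tsum_geometric]
      simp
    filter_upwards [ae_lt_top (Measurable.tsum hmeas) hfin] with z hz using hz.ne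
  have hint : ∀ᵐ z ∂lam, ∀ k, Integrable (φ k) (condExpKernel lam m z) :=
    ae_all_iff.2 fun k => (hφi k).condExpKernel_ae
  filter_upwards [hsum, hint, ae_ae_condExpKernel_eq hm (lam := lam) hhm,
    ae_measurePreserving_condExpKernel hS hinv,
    condExpKernel_ae_eq_condExp hm (μ := lam) hC] with z hz hi hc hp hzC D hD hSD
  set ρ := condExpKernel lam m z
  have hlim : Tendsto (fun k => ∫ w in D, e k w ∂ρ) atTop (𝓝 0) := by
    rw [tendsto_iff_edist_tendsto_0]
    refine tendsto_of_tendsto_of_tendsto_of_le_of_le tendsto_const_nhds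
      (ENNReal.tendsto_atTop_zero_of_tsum_ne_top hz) (fun _ => zero_le) fun k => ?_
    simp only [edist_zero_right]
    exact (enorm_integral_le_lintegral_enorm _).trans (setLIntegral_le_lintegral _ _)
  -- The coboundary integrates to `0` over `D`, as `ρ` and `D` are invariant, and `h` is `ρ`-almost
  -- everywhere the constant `h z = ρ C`.
  have hconst : ∀ k, ∫ w in D, e k w ∂ρ = ρ.real (C ∩ D) - ρ.real C * ρ.real D := by
    intro k
    have h1 : IntegrableOn (fun w => C.indicator (fun _ => (1 : ℝ)) w) D ρ :=
      ((integrable_const _).indicator hC).integrableOn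
    have h2' : Integrable h ρ := (integrable_const (h z)).congr (hc.mono fun w hw => hw.symm)
    have h3 : Integrable (fun w => φ k (S w)) ρ := hp.integrable_comp_of_integrable (hi k)
    have h4 : ∫ w in D, φ k (S w) ∂ρ = ∫ w in D, φ k w ∂ρ := by
      have hpD := hp.restrict_preimage hD
      rw [hSD] at hpD
      conv_rhs => rw [← hpD.map_eq]
      exact (integral_map hpD.measurable.aemeasurable (hφm k).aestronglyMeasurable).symm
    have h5 : ∫ w in D, e k w ∂ρ = ∫ w in D, (C.indicator (fun _ => (1 : ℝ)) w - h w) ∂ρ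
        - ∫ w in D, (φ k (S w) - φ k w) ∂ρ :=
      integral_sub (h1.sub h2'.integrableOn) (h3.sub (hi k)).integrableOn
    rw [h5, integral_sub h1 h2'.integrableOn, integral_sub h3.integrableOn (hi k).integrableOn, h4,
      sub_self, sub_zero, setIntegral_congr_ae (g := fun _ => h z) hD (hc.mono fun w hw _ => hw),
      setIntegral_indicator hC, setIntegral_const, setIntegral_const, Set.inter_comm, hzC]
    simp [mul_comm, hh]
  have := tendsto_nhds_unique (hlim.congr hconst) tendsto_const_nhds
  linarith

open ProbabilityTheory in
/-- **Ergodic decomposition**: almost every conditional measure given the invariant sets is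
ergodic. -/
theorem ae_ergodic_condExpKernel {Z : Type*} {m mZ : MeasurableSpace Z}
    [StandardBorelSpace Z] {lam : Measure Z} [IsProbabilityMeasure lam] {S : Z → Z}
    (hS : MeasurePreserving S lam lam) (hinv : m = MeasurableSpace.invariants S) :
    ∀ᵐ z ∂lam, Ergodic S (condExpKernel lam m z) := by
  obtain ⟨A, hAc, hAp, hAg, hAm⟩ := exists_countable_isPiSystem_generateFrom Z
  have key := (ae_ball_iff hAc).2 fun C hC =>
    ae_condExpKernel_inter_eq_mul hS hinv (hAm C hC)
  filter_upwards [key, ae_measurePreserving_condExpKernel hS hinv] with z hz hp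
  refine ⟨hp, ⟨fun D hD hSD => ?_⟩⟩
  set ρ := condExpKernel lam m z
  -- Independence of `D` from a generating π-system extends to all sets, in particular to `D`
  -- itself, whence `ρ D = ρ D ^ 2`.
  have heq : ρ.restrict D = ρ D • ρ := by
    refine ext_of_generate_finite A hAg hAp (fun C hC => ?_) (by simp)
    rw [Measure.restrict_apply (hAm C hC), Measure.smul_apply, smul_eq_mul, mul_comm,
      ← ENNReal.toReal_eq_toReal_iff' (by simp) (by finiteness), ENNReal.toReal_mul]
    exact hz C hC D hD hSD
  have hDD : ρ D = ρ D * ρ D := by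
    have := congrArg (fun ν => ν D) heq
    simpa [Measure.restrict_apply hD] using this
  rw [eventuallyConst_set]
  rcases eq_or_ne (ρ D) 0 with h0 | h0
  · exact Or.inr (measure_eq_zero_iff_ae_notMem.1 h0)
  · refine Or.inl ((prob_compl_eq_zero_iff hD).2 ?_)
    exact (ENNReal.mul_eq_left h0 (measure_ne_top _ _)).1 hDD.symm

open ProbabilityTheory in
/-- If `π` intertwines `S` with an ergodic transformation `T`, then almost every component of the
disintegration over the invariant sets projects to the same measure. -/
theorem ae_map_condExpKernel_eq_of_ergodic {Z X : Type*} {m mZ : MeasurableSpace Z}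
    [StandardBorelSpace Z] [MeasurableSpace X] [MeasurableSpace.CountablyGenerated X]
    {lam : Measure Z} [IsProbabilityMeasure lam] {S : Z → Z}
    (hS : MeasurePreserving S lam lam) (hinv : m = MeasurableSpace.invariants S)
    {T : X → X} {μ : Measure X} [IsProbabilityMeasure μ] (hT : Ergodic T μ) {π : Z → X}
    (hπ : MeasurePreserving π lam μ) (hπS : Function.Semiconj π S T) :
    ∀ᵐ z ∂lam, (condExpKernel lam m z).map π = μ := by
  have hm : m ≤ mZ := hinv ▸ MeasurableSpace.invariants_le S
  obtain ⟨A, hAc, hAp, hAg, hAm⟩ := exists_countable_isPiSystem_generateFrom X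
  have key : ∀ᵐ z ∂lam, ∀ C ∈ A, (condExpKernel lam m z).real (π ⁻¹' C) = μ.real C := by
    rw [ae_ball_iff hAc]
    intro C hC
    have hC := hAm C hC
    have hπC := hπ.measurable hC
    have hconst : (fun _ => μ.real C) =ᵐ[lam] lam⟦π ⁻¹' C | m⟧ := by
      refine ae_eq_condExp_of_forall_setIntegral_eq hm ((integrable_const _).indicator hπC)
        (fun _ _ _ => integrableOn_const) (fun B hB _ => ?_) aestronglyMeasurable_const
      have hB' : MeasurableSet B ∧ S ⁻¹' B = B := by
        rw [hinv] at hB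
        exact MeasurableSpace.measurableSet_invariants.1 hB
      -- The projection of `lam` restricted to an invariant set is `T`-invariant and dominated by
      -- `μ`; ergodicity makes it a multiple of `μ`, and total mass identifies the factor as `lam
      -- B`.
      let ν : Measure X := (lam.restrict B).map π
      have hνμ : ν ≤ μ := hπ.map_eq ▸ Measure.map_mono Measure.restrict_le_self hπ.measurable
      have hν : MeasurePreserving T ν ν := by
        have h1 := hS.restrict_preimage hB'.1
        rw [hB'.2] at h1
        refine ⟨hT.measurable, ?_⟩
        rw [Measure.map_map hT.measurable hπ.measurable, ← hπS.comp_eq,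
          ← Measure.map_map hπ.measurable hS.measurable, h1.map_eq]
      obtain ⟨c, hc⟩ := hT.eq_smul_of_absolutelyContinuous hν hνμ.absolutelyContinuous
      have hcB : lam B = c := by
        have := congrArg (fun ρ => ρ Set.univ) hc
        simpa [ν, Measure.map_apply hπ.measurable MeasurableSet.univ] using this
      have hcC : lam (π ⁻¹' C ∩ B) = c * μ C := by
        have := congrArg (fun ρ => ρ C) hc
        simpa [ν, Measure.map_apply hπ.measurable hC, Measure.restrict_apply hπC] using this
      rw [setIntegral_const, setIntegral_indicator hπC, setIntegral_const, Set.inter_comm,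
        measureReal_def, measureReal_def, measureReal_def, hcB, hcC]
      simp
    filter_upwards [condExpKernel_ae_eq_condExp hm (μ := lam) hπC, hconst] with z h1 h2
    rw [h1, ← h2]
  filter_upwards [key] with z hz
  have : IsProbabilityMeasure ((condExpKernel lam m z).map π) :=
    Measure.isProbabilityMeasure_map hπ.measurable.aemeasurable
  refine ext_of_generate_finite A hAg hAp (fun C hC => ?_) (by simp)
  rw [Measure.map_apply hπ.measurable (hAm C hC)]
  exact (measureReal_eq_measureReal_iff).1 (hz C hC)

/-- Any property holding almost surely for a self-joining holds almost surely for some ergodic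
self-joining. -/
theorem IsSelfJoining.exists_ergodic {X : Type*} [MeasurableSpace X] [StandardBorelSpace X]
    {μ : Measure X} [IsProbabilityMeasure μ] {T : X ≃ᵐ X} (hT : Ergodic T μ)
    {lam : Measure (X × X)} (hlam : IsSelfJoining T μ lam) {p : X × X → Prop}
    (hp : ∀ᵐ w ∂lam, p w) :
    ∃ lam' : Measure (X × X), IsSelfJoining T μ lam' ∧ Ergodic (Prod.map T T) lam' ∧
      ∀ᵐ w ∂lam', p w := by
  have hprob : IsProbabilityMeasure lam := by
    refine ⟨?_⟩
    have : lam.map Prod.fst Set.univ = 1 := by rw [hlam.fst]; exact measure_univ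
    rwa [Measure.map_apply measurable_fst MeasurableSet.univ] at this
  have h1 := ae_map_condExpKernel_eq_of_ergodic hlam.invariant rfl hT
    (π := Prod.fst) ⟨measurable_fst, hlam.fst⟩ (fun _ => rfl)
  have h2 := ae_map_condExpKernel_eq_of_ergodic hlam.invariant rfl hT
    (π := Prod.snd) ⟨measurable_snd, hlam.snd⟩ (fun _ => rfl)
  have h3 := ae_ae_condExpKernel_of_ae
    (MeasurableSpace.invariants_le (Prod.map T T)) hp
  obtain ⟨z, h1, h2, h3, h4⟩ := (h1.and (h2.and (h3.and
    (ae_ergodic_condExpKernel hlam.invariant rfl)))).exists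
  exact ⟨_, ⟨h4.toMeasurePreserving, h1, h2⟩, h4, h3⟩

/-! ### Relatively independent joinings -/

open ProbabilityTheory in
/-- The conditional distributions of the identity given an equivariant map are equivariant. -/
theorem ae_map_condDistrib_eq_of_semiconj {X W : Type*} [MeasurableSpace X] [StandardBorelSpace X]
    [Nonempty X] [MeasurableSpace W] {μ : Measure X} [IsFiniteMeasure μ] {T : X → X}
    (hT : MeasurePreserving T μ μ) {σ : W ≃ᵐ W} {F : X → W} (hF : Measurable F)
    (hFT : Function.Semiconj F T σ) :
    ∀ᵐ w ∂(μ.map F), (condDistrib id F μ w).map T = condDistrib id F μ (σ w) := by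
  have hν : MeasurePreserving σ (μ.map F) (μ.map F) := by
    refine ⟨σ.measurable, ?_⟩
    rw [Measure.map_map σ.measurable hF, ← hFT.comp_eq, ← Measure.map_map hF hT.measurable,
      hT.map_eq]
  have hcomp : ∀ᵐ w ∂(μ.map F), condDistrib id F μ w
      = ((condDistrib id F μ).map T).comap σ.symm σ.symm.measurable w := by
    -- Uniqueness of disintegration: pushing the fibre over `σ⁻¹ w` forward by `T` disintegrates the
    -- same joint law.
    refine condDistrib_ae_eq_of_measure_eq_compProd_of_measurable hF measurable_id ?_
    have h1 : μ.map (fun x => (F x, id x))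
        = (μ.map fun x => (F x, id x)).map (Prod.map σ T) := by
      rw [Measure.map_map (σ.measurable.prodMap hT.measurable) (by fun_prop)]
      conv_lhs => rw [← hT.map_eq]
      rw [Measure.map_map (by fun_prop) hT.measurable]
      congr 1
      funext x
      exact Prod.ext (hFT x) rfl
    rw [h1, ← compProd_map_condDistrib (Y := id) (X := F) measurable_id.aemeasurable]
    ext s hs
    rw [Measure.map_apply (σ.measurable.prodMap hT.measurable) hs,
      Measure.compProd_apply (σ.measurable.prodMap hT.measurable hs), Measure.compProd_apply hs]
    conv_rhs => rw [← hν.map_eq]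
    rw [lintegral_map_equiv]
    refine lintegral_congr fun w => ?_
    rw [Kernel.comap_apply, Kernel.map_apply _ hT.measurable,
      Measure.map_apply hT.measurable (measurable_prodMk_left hs), σ.symm_apply_apply]
    rfl
  filter_upwards [hν.quasiMeasurePreserving.ae hcomp] with w hw
  rw [hw, Kernel.comap_apply, Kernel.map_apply _ hT.measurable, σ.symm_apply_apply]

open ProbabilityTheory in
theorem ae_eq_of_condDistrib_id {X W : Type*} [MeasurableSpace X] [StandardBorelSpace X]
    [Nonempty X] [MeasurableSpace W] [StandardBorelSpace W] {μ : Measure X} [IsFiniteMeasure μ]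
    {F : X → W} (hF : Measurable F) :
    ∀ᵐ w ∂(μ.map F), ∀ᵐ y ∂(condDistrib id F μ w), F y = w := by
  refine Measure.ae_ae_of_ae_compProd (p := fun q => F q.2 = q.1) ?_
  rw [compProd_map_condDistrib measurable_id.aemeasurable]
  exact (ae_map_iff (by fun_prop) (measurableSet_eq_fun (hF.comp measurable_snd)
    measurable_fst)).2 (ae_of_all _ fun _ => rfl)

open ProbabilityTheory in
/-- The relatively independent self-joining over a common factor, given by two equivariant maps
with the same distribution. -/
theorem exists_isSelfJoining_of_map_eq {X W : Type*} [MeasurableSpace X] [StandardBorelSpace X]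
    [MeasurableSpace W] [StandardBorelSpace W] {μ : Measure X} [IsProbabilityMeasure μ]
    {T : X ≃ᵐ X} (hT : MeasurePreserving T μ μ) {σ : W ≃ᵐ W} {F G : X → W} (hF : Measurable F)
    (hG : Measurable G) (hFT : Function.Semiconj F T σ) (hGT : Function.Semiconj G T σ)
    (hFG : μ.map F = μ.map G) :
    ∃ lam : Measure (X × X), IsSelfJoining T μ lam ∧ ∀ᵐ w ∂lam, G w.1 = F w.2 := by
  have : Nonempty X := nonempty_of_isProbabilityMeasure μ
  set κ := condDistrib id F μ
  set η := condDistrib id G μ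
  have hν : MeasurePreserving σ (μ.map F) (μ.map F) := by
    refine ⟨σ.measurable, ?_⟩
    rw [Measure.map_map σ.measurable hF, ← hFT.comp_eq, ← Measure.map_map hF hT.measurable,
      hT.map_eq]
  have hκ : κ ∘ₘ μ.map F = μ := by
    simpa using condDistrib_comp_map (μ := μ) hF.aemeasurable measurable_id.aemeasurable
  have hη : η ∘ₘ μ.map F = μ := by
    rw [hFG]
    simpa using condDistrib_comp_map (μ := μ) hG.aemeasurable measurable_id.aemeasurable
  have hκT : ∀ᵐ w ∂(μ.map F), (κ w).map T = κ (σ w) := ae_map_condDistrib_eq_of_semiconj hT hF hFT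
  have hηT : ∀ᵐ w ∂(μ.map F), (η w).map T = η (σ w) := by
    rw [hFG]
    exact ae_map_condDistrib_eq_of_semiconj hT hG hGT
  have hκF : ∀ᵐ w ∂(μ.map F), ∀ᵐ y ∂(κ w), F y = w := ae_eq_of_condDistrib_id hF
  have hηG : ∀ᵐ w ∂(μ.map F), ∀ᵐ y ∂(η w), G y = w := by
    rw [hFG]
    exact ae_eq_of_condDistrib_id hG
  have hTT : Measurable (Prod.map T T) := T.measurable.prodMap T.measurable
  -- The joining averages `η w × κ w` over the common law of `F` and `G`; its factors live on `{G =
  -- w}` and `{F = w}`.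
  refine ⟨(η ×ₖ κ) ∘ₘ μ.map F, ⟨⟨hTT, ?_⟩, ?_, ?_⟩, ?_⟩
  · have h1 : ((η ×ₖ κ).map (Prod.map T T)) ∘ₘ μ.map F
        = ((η ×ₖ κ).comap σ σ.measurable) ∘ₘ μ.map F := by
      refine Measure.comp_congr ?_
      filter_upwards [hκT, hηT] with w h1 h2
      rw [← Kernel.map_prod_map _ _ T.measurable T.measurable, Kernel.prod_apply,
        Kernel.map_apply _ T.measurable, Kernel.map_apply _ T.measurable, h1, h2,
        Kernel.comap_apply, Kernel.prod_apply]
    rw [Measure.map_comp _ _ hTT, h1]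
    ext s hs
    rw [Measure.bind_apply hs (Kernel.aemeasurable _), Measure.bind_apply hs (Kernel.aemeasurable _)]
    conv_rhs => rw [← hν.map_eq]
    rw [lintegral_map_equiv]
    rfl
  · rw [Measure.map_comp _ _ measurable_fst, ← Kernel.fst_eq, Kernel.fst_prod, hη]
  · rw [Measure.map_comp _ _ measurable_snd, ← Kernel.snd_eq, Kernel.snd_prod, hκ]
  · refine Measure.ae_comp_of_ae_ae
      (measurableSet_eq_fun (hG.comp measurable_fst) (hF.comp measurable_snd)) ?_
    filter_upwards [hκF, hηG] with w h1 h2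
    rw [Kernel.prod_apply]
    filter_upwards [Measure.quasiMeasurePreserving_fst.ae h2,
      Measure.quasiMeasurePreserving_snd.ae h1] with p h3 h4
    rw [h3, h4]

/-! ### Integer powers of the transformation -/

theorem zIter_add_apply {X : Type*} [MeasurableSpace X] (T : X ≃ᵐ X) (m n : ℤ) (x : X) :
    zIter T (m + n) x = zIter T m (zIter T n x) := by
  simp [zIter, zpow_add]

theorem zIter_one {X : Type*} [MeasurableSpace X] (T : X ≃ᵐ X) : zIter T 1 = T := by
  simp [zIter]

theorem zIter_natCast {X : Type*} [MeasurableSpace X] (T : X ≃ᵐ X) (n : ℕ) :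
    zIter T n = T^[n] := by
  simp only [zIter, zpow_natCast, Equiv.Perm.coe_pow]
  rfl

theorem zIter_zero {X : Type*} [MeasurableSpace X] (T : X ≃ᵐ X) : zIter T 0 = id := by
  simp [zIter]

theorem measurePreserving_zIter {X : Type*} [MeasurableSpace X] {T : X ≃ᵐ X} {μ : Measure X}
    (hT : MeasurePreserving T μ μ) (n : ℤ) : MeasurePreserving (zIter T n) μ μ := by
  obtain ⟨k, rfl | rfl⟩ := n.eq_nat_or_neg
  · rw [zIter_natCast]
    exact hT.iterate k
  · refine ⟨measurable_zIter T _, ?_⟩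
    conv_lhs => rw [← (hT.iterate k).map_eq, ← zIter_natCast]
    rw [Measure.map_map (measurable_zIter T _) (measurable_zIter T _)]
    have : zIter T (-k) ∘ zIter T k = id := by
      funext x
      rw [Function.comp_apply, ← zIter_add_apply, neg_add_cancel, zIter_zero]
    rw [this, Measure.map_id]

/-! ### Limits of translates -/

/-- If `F ∘ φ k` converges almost everywhere to `G`, where every `φ k` preserves `μ`, then `F` and
`G` have the same distribution. -/
theorem map_eq_map_of_tendsto_comp_measurePreserving {X W : Type*} [MeasurableSpace X]
    [MeasurableSpace W] [TopologicalSpace W] [HasOuterApproxClosed W] [BorelSpace W]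
    {μ : Measure X} [IsFiniteMeasure μ] {φ : ℕ → X → X}
    (hφ : ∀ k, MeasurePreserving (φ k) μ μ) {F G : X → W} (hF : Measurable F) (hG : Measurable G)
    (h : ∀ᵐ x ∂μ, Tendsto (fun k => F (φ k x)) atTop (𝓝 (G x))) : μ.map F = μ.map G := by
  refine ext_of_forall_integral_eq_of_IsFiniteMeasure fun ψ => ?_
  have hψ : Measurable ψ := ψ.continuous.measurable
  rw [integral_map hF.aemeasurable hψ.aestronglyMeasurable,
    integral_map hG.aemeasurable hψ.aestronglyMeasurable]
  have hconst : ∀ k, ∫ x, ψ (F (φ k x)) ∂μ = ∫ x, ψ (F x) ∂μ := fun k => by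
    conv_rhs => rw [← (hφ k).map_eq]
    exact (integral_map (hφ k).measurable.aemeasurable
      (hψ.comp hF).aestronglyMeasurable).symm
  have hlim : Tendsto (fun k => ∫ x, ψ (F (φ k x)) ∂μ) atTop (𝓝 (∫ x, ψ (G x) ∂μ)) := by
    refine tendsto_integral_of_dominated_convergence (fun _ => ‖ψ‖)
      (fun k => (hψ.comp (hF.comp (hφ k).measurable)).aestronglyMeasurable)
      (integrable_const _) (fun k => ae_of_all _ fun x => ψ.norm_coe_le_norm _) ?_
    filter_upwards [h] with x hx using (ψ.continuous.tendsto _).comp hx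
  exact tendsto_nhds_unique (by simp only [hconst]; exact tendsto_const_nhds) hlim

/-- The left shift on bi-infinite sequences. -/
def shiftEquiv (Y : Type*) [MeasurableSpace Y] : (ℤ → Y) ≃ᵐ (ℤ → Y) where
  toFun w j := w (j + 1)
  invFun w j := w (j - 1)
  left_inv w := by simp
  right_inv w := by simp
  measurable_toFun := measurable_pi_lambda _ fun _ => measurable_pi_apply _
  measurable_invFun := measurable_pi_lambda _ fun _ => measurable_pi_apply _

/-- In a system with minimal self-joinings, any limit of translates of a function is itself a
translate, unless the function is constant. -/
theorem HasTwofoldMSJ.eq_comp_zIter_or_const {X : Type*} [MeasurableSpace X]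
    [StandardBorelSpace X] {μ : Measure X} [IsProbabilityMeasure μ] {T : X ≃ᵐ X}
    (hT : HasTwofoldMSJ T μ) {f g : X → ℂ} (hf : Measurable f) (hg : Measurable g) {n : ℕ → ℤ}
    (hlim : ∀ᵐ x ∂μ, Tendsto (fun k => f (zIter T (n k) x)) atTop (𝓝 (g x))) :
    (∃ m : ℤ, g =ᵐ[μ] f ∘ zIter T m) ∨ ∃ c : ℂ, ∀ᵐ x ∂μ, f x = c := by
  have hTμ : MeasurePreserving T μ μ := hT.ergodic.toMeasurePreserving
  -- Recording the whole orbit turns a function into a factor map onto the shift.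
  let F : (X → ℂ) → X → ℤ → ℂ := fun u x j => u (zIter T j x)
  have hF : ∀ {u : X → ℂ}, Measurable u → Measurable (F u) := fun hu =>
    measurable_pi_lambda _ fun j => hu.comp (measurable_zIter T j)
  have hFT : ∀ u, Function.Semiconj (F u) T (shiftEquiv ℂ) := fun u x => by
    funext j
    change u (zIter T j (T x)) = u (zIter T (j + 1) x)
    rw [zIter_add_apply, zIter_one]
  have hlaw : μ.map (F f) = μ.map (F g) := by
    refine map_eq_map_of_tendsto_comp_measurePreserving
      (fun k => measurePreserving_zIter hTμ (n k)) (hF hf) (hF hg) ?_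
    have : ∀ᵐ x ∂μ, ∀ j : ℤ,
        Tendsto (fun k => f (zIter T (n k) (zIter T j x))) atTop (𝓝 (g (zIter T j x))) :=
      ae_all_iff.2 fun j => (measurePreserving_zIter hTμ j).quasiMeasurePreserving.ae hlim
    filter_upwards [this] with x hx
    refine tendsto_pi_nhds.2 fun j => ?_
    refine (hx j).congr fun k => ?_
    change _ = f (zIter T j (zIter T (n k) x))
    rw [← zIter_add_apply, ← zIter_add_apply, add_comm]
  obtain ⟨lam, hlam, hae⟩ := exists_isSelfJoining_of_map_eq hTμ (hF hf) (hF hg) (hFT f) (hFT g) hlaw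
  have hae0 : ∀ᵐ w ∂lam, g w.1 = f w.2 := hae.mono fun w hw => by
    have := congrFun hw 0
    simpa only [F, zIter_zero, id] using this
  obtain ⟨lam', hlam', herg, hae'⟩ := hlam.exists_ergodic hT.ergodic hae0
  rcases hT.minimal lam' hlam' herg with rfl | ⟨m, rfl⟩
  · obtain ⟨x, hx⟩ := (Measure.ae_ae_of_ae_prod hae').exists
    exact Or.inr ⟨g x, hx.mono fun y hy => hy.symm⟩
  · exact Or.inl ⟨m, ae_of_ae_map (by have := measurable_zIter T m; fun_prop) hae'⟩

/-! ### Weak mixing and absence of periodic functions -/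

/-- A non-atomic system with twofold minimal self-joinings is weakly mixing. -/
theorem HasTwofoldMSJ.ergodic_prod {X : Type*} [MeasurableSpace X] [StandardBorelSpace X]
    {μ : Measure X} [IsProbabilityMeasure μ] [NullSingletonClass μ] {T : X ≃ᵐ X}
    (hT : HasTwofoldMSJ T μ) : Ergodic (Prod.map T T) (μ.prod μ) := by
  have hTμ : MeasurePreserving T μ μ := hT.ergodic.toMeasurePreserving
  have hjoin : IsSelfJoining T μ (μ.prod μ) :=
    ⟨hTμ.prod hTμ, by simp [Measure.map_fst_prod], by simp [Measure.map_snd_prod]⟩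
  have hgraph : ∀ᵐ w ∂(μ.prod μ), ∀ n : ℤ, w.2 ≠ zIter T n w.1 := by
    refine ae_all_iff.2 fun n => ?_
    have hmeas : MeasurableSet {w : X × X | w.2 = zIter T n w.1} :=
      measurableSet_eq_fun measurable_snd ((measurable_zIter T n).comp measurable_fst)
    exact (Measure.ae_prod_iff_ae_ae (p := fun w => w.2 ≠ zIter T n w.1) hmeas.compl).2
      (ae_of_all _ fun x => Measure.ae_ne μ (zIter T n x))
  obtain ⟨lam', hlam', herg, hae⟩ := hjoin.exists_ergodic hT.ergodic hgraph
  rcases hT.minimal lam' hlam' herg with rfl | ⟨m, rfl⟩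
  · exact herg
  · have hmeas : Measurable fun x => (x, zIter T m x) :=
      measurable_id.prodMk (measurable_zIter T m)
    obtain ⟨x, hx⟩ := (ae_of_ae_map hmeas.aemeasurable hae).exists
    exact absurd rfl (hx m)

/-- In a weakly mixing system, periodic functions are constant. -/
theorem ae_eq_const_of_comp_iterate_ae_eq {X : Type*} [MeasurableSpace X] {μ : Measure X}
    [IsProbabilityMeasure μ] {T : X → X} (hT : MeasurePreserving T μ μ)
    (hwm : Ergodic (Prod.map T T) (μ.prod μ)) {f : X → ℂ} (hf : MemLp f 2 μ) {p : ℕ} (hp : 0 < p)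
    (hper : ∀ᵐ x ∂μ, f (T^[p] x) = f x) : ∃ c : ℂ, ∀ᵐ x ∂μ, f x = c := by
  refine ⟨∫ x, f x ∂μ, ?_⟩
  set h : X → ℂ := fun x => f x - ∫ x, f x ∂μ with hh
  have hL : MemLp h 2 μ := hf.sub (memLp_const _)
  have hmean : ∫ x, h x ∂μ = 0 := by
    rw [hh, integral_sub (hf.integrable (by norm_num)) (integrable_const _)]
    simp
  let a : ℕ → X → ℂ := fun i x => h (T^[i] x)
  have haL : ∀ i, MemLp (a i) 2 μ := fun i => hL.comp_measurePreserving (hT.iterate i)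
  -- Periodicity makes `T × T` permute the summands cyclically, so `Φ` is invariant, hence constant.
  -- Integrated against `conj (h x) * h y` it gives `0`, as `h` has mean zero, but also `∑ |∫ b
  -- i|²`, whose term `i = 0` is `‖h‖⁴`.
  let Φ : X × X → ℂ := fun w => ∑ i ∈ Finset.range p, a i w.1 * starRingEnd ℂ (a i w.2)
  have hΦm : AEStronglyMeasurable Φ (μ.prod μ) := by
    refine Finset.aestronglyMeasurable_fun_sum _ fun i _ => ?_
    exact (haL i).aestronglyMeasurable.comp_fst.mul
      (RCLike.continuous_conj.comp_aestronglyMeasurable (haL i).aestronglyMeasurable.comp_snd)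
  have hap : ∀ᵐ x ∂μ, a p x = a 0 x := hper.mono fun x hx => by simp [a, hh, hx]
  have hΦinv : Φ ∘ Prod.map T T =ᵐ[μ.prod μ] Φ := by
    filter_upwards [Measure.quasiMeasurePreserving_fst.ae hap,
      Measure.quasiMeasurePreserving_snd.ae hap] with w h1 h2
    have h3 := Finset.sum_range_succ (fun i => a i w.1 * starRingEnd ℂ (a i w.2)) p
    rw [Finset.sum_range_succ' (fun i => a i w.1 * starRingEnd ℂ (a i w.2)) p, h1, h2] at h3
    exact add_right_cancel h3
  obtain ⟨c, hc⟩ := hwm.ae_eq_const_of_ae_eq_comp_ae hΦm hΦinv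
  let b : ℕ → X → ℂ := fun i x => a i x * starRingEnd ℂ (h x)
  have hb : ∀ i, Integrable (b i) μ := fun i => (haL i).integrable_mul hL.star
  have hbc : ∀ i, Integrable (fun x => starRingEnd ℂ (b i x)) μ := fun i =>
    (LinearIsometryEquiv.integrable_comp_iff Complex.conjLIE).2 (hb i)
  have hint : ∫ w, Φ w * (starRingEnd ℂ (h w.1) * h w.2) ∂(μ.prod μ) = 0 := by
    rw [integral_congr_ae (g := fun w => (c * starRingEnd ℂ (h w.1)) * h w.2)
      (hc.mono fun w hw => by simp only [hw, Function.const_apply, mul_assoc]),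
      integral_prod_mul (fun x => c * starRingEnd ℂ (h x)) h, hmean, mul_zero]
  have hsum : ∫ w, Φ w * (starRingEnd ℂ (h w.1) * h w.2) ∂(μ.prod μ)
      = ((∑ i ∈ Finset.range p, Complex.normSq (∫ x, b i x ∂μ) : ℝ) : ℂ) := by
    have h1 : ∀ w : X × X, Φ w * (starRingEnd ℂ (h w.1) * h w.2)
        = ∑ i ∈ Finset.range p, b i w.1 * starRingEnd ℂ (b i w.2) := fun w => by
      rw [Finset.sum_mul]
      refine Finset.sum_congr rfl fun i _ => ?_
      simp only [b, map_mul, Complex.conj_conj]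
      ring
    simp_rw [h1]
    rw [integral_finsetSum _ fun i _ => (hb i).mul_prod (hbc i), Complex.ofReal_sum]
    refine Finset.sum_congr rfl fun i _ => ?_
    rw [integral_prod_mul (b i) fun x => starRingEnd ℂ (b i x), integral_conj, Complex.mul_conj]
  rw [hint, eq_comm, Complex.ofReal_eq_zero,
    Finset.sum_eq_zero_iff_of_nonneg fun i _ => Complex.normSq_nonneg _] at hsum
  have h0 : ∫ x, b 0 x ∂μ = 0 := Complex.normSq_eq_zero.1 (hsum 0 (Finset.mem_range.2 hp))
  have h1 : ∫ x, Complex.normSq (h x) ∂μ = 0 := by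
    have : ∀ x, b 0 x = ((Complex.normSq (h x) : ℝ) : ℂ) := fun x => Complex.mul_conj _
    simp_rw [this] at h0
    rwa [integral_complex_ofReal, Complex.ofReal_eq_zero] at h0
  have h2 : Integrable (fun x => Complex.normSq (h x)) μ := by
    refine (hb 0).re.congr (ae_of_all _ fun x => ?_)
    simp [b, a, Complex.mul_conj]
  filter_upwards [(integral_eq_zero_iff_of_nonneg (fun x => Complex.normSq_nonneg _) h2).1 h1]
    with x hx
  exact sub_eq_zero.1 (Complex.normSq_eq_zero.1 hx)

theorem ae_eq_const_of_comp_zIter_ae_eq {X : Type*} [MeasurableSpace X] {μ : Measure X}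
    [IsProbabilityMeasure μ] {T : X ≃ᵐ X} (hT : MeasurePreserving T μ μ)
    (hwm : Ergodic (Prod.map T T) (μ.prod μ)) {f : X → ℂ} (hf : MemLp f 2 μ) {n : ℤ} (hn : n ≠ 0)
    (hper : ∀ᵐ x ∂μ, f (zIter T n x) = f x) : ∃ c : ℂ, ∀ᵐ x ∂μ, f x = c := by
  refine ae_eq_const_of_comp_iterate_ae_eq hT hwm hf (Int.natAbs_pos.2 hn) ?_
  rw [← zIter_natCast]
  rcases n.natAbs_eq with h | h
  · rwa [← h]
  · have hneg : ((n.natAbs : ℕ) : ℤ) = -n := by omega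
    rw [hneg]
    filter_upwards [(measurePreserving_zIter hT (-n)).quasiMeasurePreserving.ae hper] with x hx
    rw [← hx, ← zIter_add_apply, add_neg_cancel, zIter_zero, id]

/-! ### The orbit as a countable perfect set -/

/-- The Cantor space is uncountable. -/
theorem not_countable_nat_bool : ¬ Countable (ℕ → Bool) := by
  classical
  rintro ⟨enc, henc⟩
  refine Function.cantor_injective (fun s : Set ℕ => enc fun n => decide (n ∈ s)) fun s s' h => ?_
  ext n
  simpa using congrFun (henc h) n

theorem theorem2p4 {X : Type*} [MeasurableSpace X] [StandardBorelSpace X]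
    (μ : Measure X) [IsProbabilityMeasure μ] [NullSingletonClass μ]
    (T : X ≃ᵐ X) (hT : HasTwofoldMSJ T μ) :
    MildlyMixing T μ := by
  rintro f ⟨hf, t, ht, hlim⟩
  by_contra hconst
  have hTμ : MeasurePreserving T μ μ := hT.ergodic.toMeasurePreserving
  have hz := measurePreserving_zIter hTμ
  have haper : ∀ n : ℤ, n ≠ 0 → ¬ ∀ᵐ x ∂μ, f (zIter T n x) = f x := fun n hn h =>
    hconst (ae_eq_const_of_comp_zIter_ae_eq hTμ hT.ergodic_prod hf hn h)
  have hfn : ∀ n : ℤ, MemLp (fun x => f (zIter T n x)) 2 μ := fun n =>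
    hf.comp_measurePreserving (hz n)
  let u : ℤ → Lp ℂ 2 μ := fun n => (hfn n).toLp _
  have hu : ∀ n, u n =ᵐ[μ] fun x => f (zIter T n x) := fun n => (hfn n).coeFn_toLp
  -- Composition with `T ^ n` is an isometry, so rigidity at `f` transfers to every point of the
  -- orbit.
  have hedist : ∀ n k : ℤ, edist (u (k + n)) (u n)
      = eLpNorm (fun x => f (zIter T k x) - f x) 2 μ := by
    intro n k
    rw [Lp.edist_toLp_toLp]
    have h1 : AEStronglyMeasurable (fun x => f (zIter T k x) - f x) μ :=
      ((hfn k).sub hf).aestronglyMeasurable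
    rw [← eLpNorm_comp_measurePreserving h1 (hz n)]
    congr 1
    funext x
    simp only [Pi.sub_apply, Function.comp_apply, zIter_add_apply]
  have hclosure : closure (Set.range u) ⊆ Set.range u := by
    intro g hg
    obtain ⟨y, hy, hyg⟩ := mem_closure_iff_seq_limit.1 hg
    choose n hn using hy
    -- A subsequence converges almost everywhere, as the joining argument requires.
    obtain ⟨ns, -, hns⟩ := (tendstoInMeasure_of_tendsto_Lp hyg).exists_seq_tendsto_ae
    have h0 : f =ᵐ[μ] u 0 := (hu 0).symm.mono fun x hx => by simpa [zIter_zero] using hx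
    have hall : ∀ᵐ x ∂μ, ∀ k : ℤ, u k x = u 0 (zIter T k x) := ae_all_iff.2 fun k =>
      (hu k).trans ((hz k).quasiMeasurePreserving.ae_eq_comp h0)
    have hconv : ∀ᵐ x ∂μ, Tendsto (fun k => u 0 (zIter T (n (ns k)) x)) atTop (𝓝 (g x)) := by
      filter_upwards [hns, hall] with x h1 h2
      refine h1.congr fun k => ?_
      rw [← hn, h2]
    rcases hT.eq_comp_zIter_or_const (Lp.stronglyMeasurable (u 0)).measurable
      (Lp.stronglyMeasurable g).measurable hconv with ⟨m, hm⟩ | ⟨c, hc⟩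
    · refine ⟨m, Lp.ext ?_⟩
      filter_upwards [hm, hall] with x h1 h2
      rw [h1, h2]
      rfl
    · exact absurd ⟨c, h0.trans hc⟩ hconst
  have hpre : Preperfect (Set.range u) := by
    rw [preperfect_iff_nhds]
    rintro _ ⟨n, rfl⟩ U hU
    have htend : Tendsto (fun i => u (t i + n)) atTop (𝓝 (u n)) := by
      rw [tendsto_iff_edist_tendsto_0]
      simpa only [hedist] using hlim
    have hne : ∀ᶠ i in atTop, t i ≠ 0 := by
      rw [cocompact_eq_cofinite] at ht
      exact ht.eventually (eventually_cofinite_ne 0)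
    obtain ⟨i, h1, h2⟩ := ((htend.eventually_mem hU).and hne).exists
    refine ⟨u (t i + n), ⟨h1, t i + n, rfl⟩, fun h => haper _ h2 ?_⟩
    have h3 := hedist n (t i)
    rw [h, edist_self] at h3
    have h4 : AEStronglyMeasurable (fun x => f (zIter T (t i) x) - f x) μ :=
      ((hfn _).sub hf).aestronglyMeasurable
    exact ((eLpNorm_eq_zero_iff h4 (by norm_num)).1 h3.symm).mono fun x hx => sub_eq_zero.1 hx
  -- A nonempty perfect set in a complete metric space contains an injective image of the Cantor
  -- space; here it lies in the countable orbit.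
  obtain ⟨e, he, -, hinj⟩ := hpre.perfect_closure.exists_nat_bool_injection
    (Set.range_nonempty u).closure
  have hcount : (Set.univ : Set (ℕ → Bool)).Countable :=
    Set.MapsTo.countable_of_injOn (fun x _ => hclosure (he ⟨x, rfl⟩)) hinj.injOn
      (Set.countable_range u)
  exact not_countable_nat_bool (Set.countable_univ_iff.1 hcount)
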